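/- Let $N\ge 1$ and $\alpha\ge 0$, and let functions on $\mathbb R^N$ be real- or complex-valued. A cube is a closed, nondegenerate cube with sides parallel to the coordinate axes; $|Q|$ is its Lebesgue measure. A special cube is a cube of the form $\prod_{i=1}^N[(k_i-1)2^n,(k_i+1)2^n]$ with $n,k_1,\dots,k_N\in\mathbb Z$, i.e. a product of intervals of the same length each of which is a dyadic interval or the shift of a dyadic interval by half its length; $\mathcal D_0$ is the family of all special cubes. For a cube $Q$ and a locally square-integrable function $g$, let $p_Q(g)$ be the unique polynomial of degree at most $[\alpha]$ such that $\int_Q (g(x)-p_Q(g)(x))\,x^\beta\,dx=0$ for all multi-indices $\beta$ with $|\beta|\le[\alpha]$. For a family $\mathcal J$ of cubes put $$M^{\sharp,2}_{\alpha,\mathcal J}g(x)=\sup_{x\in Q,\;Q\in\mathcal J}\frac1{|Q|^{\alpha/N}}\Big(\frac1{|Q|}\int_Q|g(y)-p_Q(g)(y)|^2\,dy\Big)^{1/2},\qquad \|g\|_{\Lambda_{\alpha,\mathcal J}}=\|M^{\sharp,2}_{\alpha,\mathcal J}g\|_{L^\infty}\in[0,\infty],$$ and let $\Lambda_{\alpha,\mathcal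 J}$ be the set of locally square-integrable functions $g$ with $\|g\|_{\Lambda_{\alpha,\mathcal J}}<\infty$. Write $\Lambda_\alpha$ and $\|\cdot\|_{\Lambda_\alpha}$ when $\mathcal J$ is the family of all cubes. Proposition. $\Lambda_\alpha=\Lambda_{\alpha,\mathcal D_0}$, and there are constants $0<c,C<\infty$ depending only on $\alpha$ and $N$ such that $$c\,\|g\|_{\Lambda_{\alpha,\mathcal D_0}}\le\|g\|_{\Lambda_\alpha}\le C\,\|g\|_{\Lambda_{\alpha,\mathcal D_0}}$$ for every locally square-integrable function $g$. -/

import Mathlib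

open MeasureTheory
open scoped ENNReal NNReal

noncomputable section

/-- `g` is locally square-integrable on `ℝ^N` (with its Lebesgue measure `volume`). -/
def LocallySquareIntegrable {𝕜 : Type*} [RCLike 𝕜] {N : ℕ} (g : (Fin N → ℝ) → 𝕜) : Prop :=
  ∀ K : Set (Fin N → ℝ), IsCompact K → MemLp g 2 (volume.restrict K)

/-- The family of all (closed, nondegenerate, axis-parallel) cubes in `ℝ^N`. -/
def allCubes (N : ℕ) : Set (Set (Fin N → ℝ)) :=
  {Q | ∃ (a : Fin N → ℝ) (l : ℝ), 0 < l ∧ Q = Set.Icc a (fun i => a i + l)}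

/-- The family of special cubes: the products `∏ i, [(k i - 1) 2^n, (k i + 1) 2^n]`, with
`n` and all `k i` arbitrary integers. -/
def specialCubes (N : ℕ) : Set (Set (Fin N → ℝ)) :=
  {Q | ∃ (n : ℤ) (k : Fin N → ℤ),
    Q = Set.Icc (fun i => ((k i : ℝ) - 1) * (2 : ℝ) ^ n) (fun i => ((k i : ℝ) + 1) * (2 : ℝ) ^ n)}

/-- The value at a point of `ℝ^N` of a polynomial with coefficients in `𝕜` (`ℝ` or `ℂ`). -/
def polyVal {𝕜 : Type*} [RCLike 𝕜] {N : ℕ} (p : MvPolynomial (Fin N) 𝕜) (x : Fin N → ℝ) : 𝕜 :=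
  MvPolynomial.eval (fun i => (x i : 𝕜)) p

/-- The function `h χ_Q` has vanishing moments up to order `d`. -/
def VanishingMoments {𝕜 : Type*} [RCLike 𝕜] {N : ℕ} (d : ℕ) (Q : Set (Fin N → ℝ))
    (h : (Fin N → ℝ) → 𝕜) : Prop :=
  ∀ β : Fin N → ℕ, ∑ i, β i ≤ d → ∫ x in Q, h x * ∏ i, (x i : 𝕜) ^ β i = 0

/-- `p` has degree at most `d` and `(g - p) χ_Q` has vanishing moments up to order `d`. -/
def IsMomentPoly {𝕜 : Type*} [RCLike 𝕜] {N : ℕ} (d : ℕ) (Q : Set (Fin N → ℝ))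
    (g : (Fin N → ℝ) → 𝕜) (p : MvPolynomial (Fin N) 𝕜) : Prop :=
  p.totalDegree ≤ d ∧ VanishingMoments d Q (fun x => g x - polyVal p x)

open Classical in
/-- The polynomial `p_Q(g)` of degree at most `d` for which `(g - p_Q(g)) χ_Q` has vanishing
moments up to order `d`. For a cube `Q` and a locally integrable `g` it exists and is unique;
the default value `0` is never used for them. -/
def momentPoly {𝕜 : Type*} [RCLike 𝕜] {N : ℕ} (d : ℕ) (Q : Set (Fin N → ℝ))
    (g : (Fin N → ℝ) → 𝕜) : MvPolynomial (Fin N) 𝕜 :=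
  if h : ∃ p, IsMomentPoly d Q g p then h.choose else 0

/-- The quantity
`|Q|^(-α/N) * ((1/|Q|) ∫_Q |g - p_Q(g)|²)^(1/2)`, where `p_Q(g)` has degree at most `[α]`. -/
def cubeOscillation {𝕜 : Type*} [RCLike 𝕜] {N : ℕ} (α : ℝ) (g : (Fin N → ℝ) → 𝕜)
    (Q : Set (Fin N → ℝ)) : ℝ≥0∞ :=
  (volume Q ^ (α / N))⁻¹ *
    ((volume Q)⁻¹ * ∫⁻ y in Q, ‖g y - polyVal (momentPoly ⌊α⌋₊ Q g) y‖ₑ ^ 2) ^ (1 / 2 : ℝ)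

/-- The sharp maximal function: the supremum of the oscillations of `g` over the cubes of the
family `J` that contain `x`. -/
def sharpMaximal {𝕜 : Type*} [RCLike 𝕜] {N : ℕ} (α : ℝ) (J : Set (Set (Fin N → ℝ)))
    (g : (Fin N → ℝ) → 𝕜) (x : Fin N → ℝ) : ℝ≥0∞ :=
  ⨆ Q ∈ J, ⨆ _ : x ∈ Q, cubeOscillation α g Q

/-- The Lipschitz norm: the `L^∞` norm (essential supremum) of the sharp maximal function,
with value `∞` when the latter is not essentially bounded. -/
def lipNorm {𝕜 : Type*} [RCLike 𝕜] {N : ℕ} (α : ℝ) (J : Set (Set (Fin N → ℝ)))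
    (g : (Fin N → ℝ) → 𝕜) : ℝ≥0∞ :=
  eLpNorm (sharpMaximal α J g) ∞ volume

/-- The Lipschitz class of the family `J`: the locally square-integrable functions whose sharp
maximal function is essentially bounded. -/
def lipSpace (𝕜 : Type*) [RCLike 𝕜] {N : ℕ} (α : ℝ) (J : Set (Set (Fin N → ℝ))) :
    Set ((Fin N → ℝ) → 𝕜) :=
  {g | LocallySquareIntegrable g ∧ lipNorm α J g < ∞}

end

/-!
The `L²(Q)` class of `p_Q(g)` is the orthogonal projection of `g` onto the polynomials of degree at
most `d`, because vanishing moments mean orthogonality to all monomials of degree at most `d`.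
Hence `p_Q(g)` is the best approximation of `g`, so for `Q ⊆ R` the `L²(Q)` error of `p_Q(g)` is at
most that of `p_R(g)`, and thus at most the `L²(R)` error of `p_R(g)`. Passing from `Q` to `R` costs
only a power of `|R| / |Q|`, and every cube lies in a special cube of at most `4 ^ N` times its
volume.
-/

section PolynomialProjection

theorem memLp_restrict_of_continuousOn {X E : Type*} [TopologicalSpace X]
    [TopologicalSpace.PseudoMetrizableSpace X] [MeasurableSpace X] [OpensMeasurableSpace X]
    [NormedAddCommGroup E] {μ : Measure X} [IsFiniteMeasureOnCompacts μ] {f : X → E} {K : Set X}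
    (hf : ContinuousOn f K) (hK : IsCompact K) (hKm : MeasurableSet K) (p : ℝ≥0∞) :
    MemLp f p (μ.restrict K) := by
  have : IsFiniteMeasure (μ.restrict K) := isFiniteMeasure_restrict.mpr hK.measure_lt_top.ne
  obtain ⟨C, hC⟩ := hK.exists_bound_of_continuousOn hf
  exact .of_bound (hf.aestronglyMeasurable_of_isCompact hK hKm) C (ae_restrict_of_forall_mem hKm hC)

theorem norm_sub_le_of_sub_mem_orthogonal {𝕜 E : Type*} [RCLike 𝕜] [NormedAddCommGroup E]
    [InnerProductSpace 𝕜 E] {K : Submodule 𝕜 E} {u v w : E} (hv : v ∈ K) (huv : u - v ∈ Kᗮ)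
    (hw : w ∈ K) : ‖u - v‖ ≤ ‖u - w‖ := by
  rw [(K.norm_eq_iInf_iff_inner_eq_zero hv).mpr (K.mem_orthogonal' _ |>.mp huv)]
  exact ciInf_le ⟨0, Set.forall_mem_range.mpr fun _ => norm_nonneg _⟩ (⟨w, hw⟩ : K)

variable {𝕜 : Type*} [RCLike 𝕜] {N : ℕ} {Q : Set (Fin N → ℝ)}

theorem continuous_polyVal (p : MvPolynomial (Fin N) 𝕜) : Continuous (polyVal p) :=
  (MvPolynomial.continuous_eval p).comp (by fun_prop)

theorem polyVal_monomial_one (β : Fin N →₀ ℕ) (x : Fin N → ℝ) :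
    polyVal (MvPolynomial.monomial β (1 : 𝕜)) x = ∏ i, (x i : 𝕜) ^ β i := by
  rw [polyVal, MvPolynomial.eval_monomial, one_mul, Finsupp.prod_fintype _ _ fun _ => pow_zero _]

theorem memLp_polyVal (hQ : IsCompact Q) (p : MvPolynomial (Fin N) 𝕜) :
    MemLp (polyVal p) 2 (volume.restrict Q) :=
  memLp_restrict_of_continuousOn (continuous_polyVal p).continuousOn hQ hQ.measurableSet 2

/-- The map sending a polynomial to its class in `L²(Q)`. -/
noncomputable def polyToLp (hQ : IsCompact Q) :
    MvPolynomial (Fin N) 𝕜 →ₗ[𝕜] Lp 𝕜 2 (volume.restrict Q) where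
  toFun p := (memLp_polyVal hQ p).toLp _
  map_add' p q := by
    rw [← MemLp.toLp_add]
    exact MemLp.toLp_congr _ _ (ae_of_all _ fun x => by simp [polyVal])
  map_smul' c p := by
    rw [RingHom.id_apply, ← MemLp.toLp_const_smul]
    exact MemLp.toLp_congr _ _ (ae_of_all _ fun x => by simp [polyVal])

theorem coeFn_polyToLp (hQ : IsCompact Q) (p : MvPolynomial (Fin N) 𝕜) :
    polyToLp hQ p =ᵐ[volume.restrict Q] polyVal p :=
  (memLp_polyVal hQ p).coeFn_toLp

/-- The classes in `L²(Q)` of the polynomials of degree at most `d`, the subspace onto which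
`g ↦ p_Q(g)` projects. -/
noncomputable def polySubspace (𝕜 : Type*) [RCLike 𝕜] (d : ℕ) (hQ : IsCompact Q) :
    Submodule 𝕜 (Lp 𝕜 2 (volume.restrict Q)) :=
  (MvPolynomial.restrictTotalDegree (Fin N) 𝕜 d).map (polyToLp hQ)

theorem polyToLp_mem_polySubspace {d : ℕ} (hQ : IsCompact Q) {p : MvPolynomial (Fin N) 𝕜}
    (hp : p.totalDegree ≤ d) : polyToLp hQ p ∈ polySubspace 𝕜 d hQ :=
  Submodule.mem_map_of_mem ((MvPolynomial.mem_restrictTotalDegree _ _ _).mpr hp)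

theorem toLp_sub_polyToLp (hQ : IsCompact Q) {g : (Fin N → ℝ) → 𝕜}
    (hg : MemLp g 2 (volume.restrict Q)) (p : MvPolynomial (Fin N) 𝕜) :
    hg.toLp g - polyToLp hQ p = (hg.sub (memLp_polyVal hQ p)).toLp (fun x => g x - polyVal p x) :=
  (MemLp.toLp_sub hg (memLp_polyVal hQ p)).symm

theorem inner_polyToLp_monomial (hQ : IsCompact Q) {h : (Fin N → ℝ) → 𝕜}
    (hh : MemLp h 2 (volume.restrict Q)) (β : Fin N →₀ ℕ) :
    inner 𝕜 (polyToLp hQ (MvPolynomial.monomial β (1 : 𝕜))) (hh.toLp h) =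
      ∫ x in Q, h x * ∏ i, (x i : 𝕜) ^ β i := by
  rw [L2.inner_def]
  refine integral_congr_ae ?_
  filter_upwards [coeFn_polyToLp hQ (MvPolynomial.monomial β (1 : 𝕜)), hh.coeFn_toLp]
    with x hβx hhx
  rw [hβx, hhx, RCLike.inner_apply, polyVal_monomial_one]
  simp only [map_prod, map_pow, RCLike.conj_ofReal]

theorem vanishingMoments_iff_toLp_mem_orthogonal (d : ℕ) (hQ : IsCompact Q)
    {h : (Fin N → ℝ) → 𝕜} (hh : MemLp h 2 (volume.restrict Q)) :
    VanishingMoments d Q h ↔ hh.toLp h ∈ (polySubspace 𝕜 d hQ)ᗮ := by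
  have hspan : polySubspace 𝕜 d hQ = Submodule.span 𝕜
      ((fun β => polyToLp hQ (MvPolynomial.monomial β 1)) ''
        {β : Fin N →₀ ℕ | (β.sum fun _ e => e) ≤ d}) := by
    rw [polySubspace, MvPolynomial.restrictTotalDegree, MvPolynomial.restrictSupport_eq_span,
      Submodule.map_span, Set.image_image]
  rw [hspan, ← Submodule.span_singleton_le_iff_mem, ← Submodule.isOrtho_iff_le,
    Submodule.isOrtho_comm, Submodule.isOrtho_span, Set.forall_mem_image]
  simp only [Set.mem_singleton_iff, forall_eq, Set.mem_ofPred_eq, inner_polyToLp_monomial,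
    Finsupp.sum_fintype, implies_true, VanishingMoments]
  exact Finsupp.equivFunOnFinite.symm.forall_congr fun β => Iff.rfl

theorem isMomentPoly_iff {d : ℕ} (hQ : IsCompact Q) {g : (Fin N → ℝ) → 𝕜}
    (hg : MemLp g 2 (volume.restrict Q)) {p : MvPolynomial (Fin N) 𝕜} :
    IsMomentPoly d Q g p ↔
      p.totalDegree ≤ d ∧ hg.toLp g - polyToLp hQ p ∈ (polySubspace 𝕜 d hQ)ᗮ := by
  rw [IsMomentPoly, toLp_sub_polyToLp, vanishingMoments_iff_toLp_mem_orthogonal]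

theorem exists_isMomentPoly (d : ℕ) (hQ : IsCompact Q) {g : (Fin N → ℝ) → 𝕜}
    (hg : MemLp g 2 (volume.restrict Q)) : ∃ p, IsMomentPoly d Q g p := by
  have : FiniteDimensional 𝕜 (polySubspace 𝕜 d hQ) := by unfold polySubspace; infer_instance
  obtain ⟨_, ⟨p, hp, rfl⟩, horth⟩ :=
    Submodule.HasOrthogonalProjection.exists_orthogonal (K := polySubspace 𝕜 d hQ) (hg.toLp g)
  exact ⟨p, (isMomentPoly_iff hQ hg).mpr
    ⟨(MvPolynomial.mem_restrictTotalDegree _ _ _).mp hp, horth⟩⟩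

theorem isMomentPoly_momentPoly (d : ℕ) (hQ : IsCompact Q) {g : (Fin N → ℝ) → 𝕜}
    (hg : MemLp g 2 (volume.restrict Q)) : IsMomentPoly d Q g (momentPoly d Q g) := by
  have h := exists_isMomentPoly d hQ hg
  rw [momentPoly, dif_pos h]
  exact h.choose_spec

theorem IsMomentPoly.eLpNorm_sub_le {d : ℕ} {g : (Fin N → ℝ) → 𝕜} {p q : MvPolynomial (Fin N) 𝕜}
    (hp : IsMomentPoly d Q g p) (hQ : IsCompact Q) (hg : MemLp g 2 (volume.restrict Q))
    (hq : q.totalDegree ≤ d) :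
    eLpNorm (fun x => g x - polyVal p x) 2 (volume.restrict Q) ≤
      eLpNorm (fun x => g x - polyVal q x) 2 (volume.restrict Q) := by
  have hnorm : ‖hg.toLp g - polyToLp hQ p‖ₑ ≤ ‖hg.toLp g - polyToLp hQ q‖ₑ :=
    enorm_le_iff_norm_le.mpr <| norm_sub_le_of_sub_mem_orthogonal
      (polyToLp_mem_polySubspace hQ hp.1) ((isMomentPoly_iff hQ hg).mp hp).2
      (polyToLp_mem_polySubspace hQ hq)
  simpa only [toLp_sub_polyToLp, Lp.enorm_toLp] using hnorm

theorem eLpNorm_sub_momentPoly_le_of_subset (d : ℕ) {g : (Fin N → ℝ) → 𝕜} {R : Set (Fin N → ℝ)}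
    (hQ : IsCompact Q) (hR : IsCompact R) (hg : MemLp g 2 (volume.restrict R)) (hQR : Q ⊆ R) :
    eLpNorm (fun x => g x - polyVal (momentPoly d Q g) x) 2 (volume.restrict Q) ≤
      eLpNorm (fun x => g x - polyVal (momentPoly d R g) x) 2 (volume.restrict R) := by
  have hμ : volume.restrict Q ≤ volume.restrict R := Measure.restrict_mono_set _ hQR
  have hgQ := hg.mono_measure hμ
  calc _ ≤ eLpNorm (fun x => g x - polyVal (momentPoly d R g) x) 2 (volume.restrict Q) :=
        (isMomentPoly_momentPoly d hQ hgQ).eLpNorm_sub_le hQ hgQ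
          (isMomentPoly_momentPoly d hR hg).1
    _ ≤ _ := eLpNorm_mono_measure _ hμ

end PolynomialProjection

section Oscillation

variable {𝕜 : Type*} [RCLike 𝕜] {N : ℕ} {α : ℝ}

theorem cubeOscillation_eq_mul_eLpNorm (hα : 0 ≤ α) (g : (Fin N → ℝ) → 𝕜) (Q : Set (Fin N → ℝ)) :
    cubeOscillation α g Q = (volume Q)⁻¹ ^ (α / N + 1 / 2) *
      eLpNorm (fun y => g y - polyVal (momentPoly ⌊α⌋₊ Q g) y) 2 (volume.restrict Q) := by
  rw [cubeOscillation, ENNReal.mul_rpow_of_nonneg _ _ one_half_pos.le, ← mul_assoc,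
    ← ENNReal.inv_rpow, ← ENNReal.rpow_add_of_nonneg _ _ (by positivity) one_half_pos.le,
    eLpNorm_eq_lintegral_rpow_enorm_toReal two_ne_zero ENNReal.ofNat_ne_top]
  simp only [ENNReal.toReal_ofNat, ENNReal.rpow_ofNat]

theorem cubeOscillation_le_of_subset (hα : 0 ≤ α) {g : (Fin N → ℝ) → 𝕜} {Q R : Set (Fin N → ℝ)}
    (hQ : IsCompact Q) (hR : IsCompact R) (hg : MemLp g 2 (volume.restrict R)) (hQR : Q ⊆ R)
    {K : ℝ≥0} (hK : K ≠ 0) (hvol : volume R ≤ K * volume Q) :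
    cubeOscillation α g Q ≤ (K ^ (α / N + 1 / 2) : ℝ≥0) * cubeOscillation α g R := by
  have hexp : 0 ≤ α / N + 1 / 2 := by positivity
  have hinv : (volume Q)⁻¹ ≤ K * (volume R)⁻¹ := by
    rw [← div_eq_mul_inv, ENNReal.le_div_iff_mul_le (.inr (by simpa using hK)) (.inr (by simp)),
      mul_comm, ← div_eq_mul_inv]
    exact ENNReal.div_le_of_le_mul hvol
  calc cubeOscillation α g Q
      ≤ (K * (volume R)⁻¹) ^ (α / N + 1 / 2) *
          eLpNorm (fun y => g y - polyVal (momentPoly ⌊α⌋₊ R g) y) 2 (volume.restrict R) := by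
        rw [cubeOscillation_eq_mul_eLpNorm hα]
        gcongr
        exact eLpNorm_sub_momentPoly_le_of_subset _ hQ hR hg hQR
    _ = _ := by
        rw [cubeOscillation_eq_mul_eLpNorm hα, ENNReal.mul_rpow_of_nonneg _ _ hexp,
          ENNReal.coe_rpow_of_nonneg _ hexp, mul_assoc]

end Oscillation

section Norms

variable {𝕜 : Type*} [RCLike 𝕜] {N : ℕ} {α : ℝ} {I J : Set (Set (Fin N → ℝ))} {K : ℝ≥0}

theorem lipNorm_mono (hIJ : I ⊆ J) (g : (Fin N → ℝ) → 𝕜) : lipNorm α I g ≤ lipNorm α J g :=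
  eLpNorm_mono_enorm fun _ => biSup_mono hIJ

theorem lipSpace_anti (hIJ : I ⊆ J) : lipSpace 𝕜 α J ⊆ lipSpace 𝕜 α I :=
  fun g hg => ⟨hg.1, (lipNorm_mono hIJ g).trans_lt hg.2⟩

/-- Each set of the family `I` lies in a set of the family `J` of at most `K` times its volume. -/
def DominatedBy (K : ℝ≥0) (I J : Set (Set (Fin N → ℝ))) : Prop :=
  ∀ Q ∈ I, ∃ R ∈ J, Q ⊆ R ∧ volume R ≤ K * volume Q

theorem DominatedBy.sharpMaximal_le (h : DominatedBy K I J) (hK : K ≠ 0)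
    (hI : ∀ Q ∈ I, IsCompact Q) (hJ : ∀ R ∈ J, IsCompact R) (hα : 0 ≤ α) {g : (Fin N → ℝ) → 𝕜}
    (hg : LocallySquareIntegrable g) (x : Fin N → ℝ) :
    sharpMaximal α I g x ≤ (K ^ (α / N + 1 / 2) : ℝ≥0) * sharpMaximal α J g x := by
  refine iSup₂_le fun Q hQ => iSup_le fun hx => ?_
  obtain ⟨R, hR, hQR, hvol⟩ := h Q hQ
  calc cubeOscillation α g Q
      ≤ (K ^ (α / N + 1 / 2) : ℝ≥0) * cubeOscillation α g R :=
        cubeOscillation_le_of_subset hα (hI Q hQ) (hJ R hR) (hg R (hJ R hR)) hQR hK hvol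
    _ ≤ _ := by
        gcongr
        exact le_iSup₂_of_le R hR (le_iSup_of_le (hQR hx) le_rfl)

theorem DominatedBy.lipNorm_le (h : DominatedBy K I J) (hK : K ≠ 0)
    (hI : ∀ Q ∈ I, IsCompact Q) (hJ : ∀ R ∈ J, IsCompact R) (hα : 0 ≤ α) {g : (Fin N → ℝ) → 𝕜}
    (hg : LocallySquareIntegrable g) :
    lipNorm α I g ≤ (K ^ (α / N + 1 / 2) : ℝ≥0) * lipNorm α J g :=
  eLpNorm_le_nnreal_smul_eLpNorm_of_ae_le_mul'
    (ae_of_all _ fun x => h.sharpMaximal_le hK hI hJ hα hg x) ∞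

theorem DominatedBy.lipSpace_subset (h : DominatedBy K I J) (hK : K ≠ 0)
    (hI : ∀ Q ∈ I, IsCompact Q) (hJ : ∀ R ∈ J, IsCompact R) (hα : 0 ≤ α) :
    lipSpace 𝕜 α J ⊆ lipSpace 𝕜 α I := fun _ hg =>
  ⟨hg.1, (h.lipNorm_le hK hI hJ hα hg.1).trans_lt (ENNReal.mul_lt_top ENNReal.coe_lt_top hg.2)⟩

end Norms

section Cubes

variable {N : ℕ}

theorem isCompact_of_mem_allCubes {Q : Set (Fin N → ℝ)} (hQ : Q ∈ allCubes N) : IsCompact Q := by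
  obtain ⟨a, l, -, rfl⟩ := hQ
  exact isCompact_Icc

theorem specialCubes_subset_allCubes : specialCubes N ⊆ allCubes N := by
  rintro _ ⟨n, k, rfl⟩
  refine ⟨fun i => ((k i : ℝ) - 1) * 2 ^ n, 2 * 2 ^ n, by positivity, ?_⟩
  congr 1 with i
  ring

theorem Icc_subset_specialCube (a : Fin N → ℝ) {l : ℝ} {n : ℤ} (hl : l ≤ 2 ^ n) :
    Set.Icc a (fun i => a i + l) ⊆
      Set.Icc (fun i => (((⌊a i / 2 ^ n⌋ + 1 : ℤ) : ℝ) - 1) * 2 ^ n)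
        (fun i => (((⌊a i / 2 ^ n⌋ + 1 : ℤ) : ℝ) + 1) * 2 ^ n) := by
  have hn : (0 : ℝ) < 2 ^ n := by positivity
  refine Set.Icc_subset_Icc (fun i => ?_) fun i => ?_
  · have := (le_div_iff₀ hn).mp (Int.floor_le (a i / 2 ^ n))
    push_cast
    linarith
  · have := (div_lt_iff₀ hn).mp (Int.lt_floor_add_one (a i / 2 ^ n))
    push_cast
    linarith

theorem allCubes_dominatedBy_specialCubes : DominatedBy (4 ^ N) (allCubes N) (specialCubes N) := by
  rintro _ ⟨a, l, hl, rfl⟩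
  obtain ⟨m, hm, hm'⟩ := exists_mem_Ioc_zpow hl one_lt_two
  refine ⟨_, ⟨m + 1, _, rfl⟩, Icc_subset_specialCube a hm', ?_⟩
  have hside (t : ℝ) : (t + 1) * 2 ^ (m + 1) - (t - 1) * 2 ^ (m + 1) ≤ 4 * l := by
    rw [zpow_add_one₀ two_ne_zero]
    linarith
  rw [Real.volume_Icc_pi, Real.volume_Icc_pi]
  calc _ ≤ ∏ _i : Fin N, ENNReal.ofReal (4 * l) :=
        Finset.prod_le_prod' fun i _ => ENNReal.ofReal_le_ofReal (hside _)
    _ = _ := by simp [ENNReal.ofReal_mul, mul_pow]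

end Cubes

theorem proposition2p1 {𝕜 : Type*} [RCLike 𝕜] (N : ℕ) (hN : 1 ≤ N) (α : ℝ) (hα : 0 ≤ α) :
    lipSpace 𝕜 α (allCubes N) = lipSpace 𝕜 α (specialCubes N) ∧
    ∃ c C : ℝ≥0, 0 < c ∧ 0 < C ∧
      ∀ g : (Fin N → ℝ) → 𝕜, LocallySquareIntegrable g →
        c * lipNorm α (specialCubes N) g ≤ lipNorm α (allCubes N) g ∧
        lipNorm α (allCubes N) g ≤ C * lipNorm α (specialCubes N) g := by
  have hK : (4 ^ N : ℝ≥0) ≠ 0 := by positivity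
  have hspecial : ∀ R ∈ specialCubes N, IsCompact R := fun R hR =>
    isCompact_of_mem_allCubes (specialCubes_subset_allCubes hR)
  have hdom := allCubes_dominatedBy_specialCubes (N := N)
  refine ⟨(lipSpace_anti specialCubes_subset_allCubes).antisymm
      (hdom.lipSpace_subset hK (fun _ => isCompact_of_mem_allCubes) hspecial hα),
    1, (4 ^ N) ^ (α / N + 1 / 2), one_pos, NNReal.rpow_pos (pos_of_ne_zero hK),
    fun g hg => ⟨?_, hdom.lipNorm_le hK (fun _ => isCompact_of_mem_allCubes) hspecial hα hg⟩⟩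
  rw [ENNReal.coe_one, one_mul]
  exact lipNorm_mono specialCubes_subset_allCubes g
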